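/- All codes are binary. A classical code is given by a parity-check matrix $H$; it has parameters $[n,k,d]$ if it has $n$ bits, $\dim\ker H=k$, and $d$ is the minimal Hamming weight of a nonzero element of $\ker H$. A stabilizer code on $n$ qubits is given by a check matrix $S$ with $2n$ columns in the symplectic representation $(x\,|\,z)$, with pairwise symplectically orthogonal rows; it has parameters $[[n,k,d]]$ if $k=n-\operatorname{rank}S$ and $d$ is the minimal number of qubits on which a Pauli operator acts that commutes with all checks but is not a product of checks (a logical operator). The distance $d_x$ (resp. $d_z$) is the minimal weight of a logical operator of pure $X$ (resp. $Z$) type. The check weight is the maximal number of nonzero entries in a row of $S$; the qubit-use count is the maximum, over qubits, of the total number of nonzero entries in the two columns of that qubit; $q_x$ and $q_z$ are the maximal column weights among the $X$-checks and among the $Z$-checks. A code family is geometrically local in dimension $\delta$ if there is a constant $R$ such that, for every member, the (qu)bits can be placed at distinct points of $\mathbb Z^\delta$ (no wrap-around) with any two (qu)bits in the support of a common check differing by at most $R$ in each coordinate. Let $l=2^m$ with $m\ge 2$ and let $h\in\{l,\,l/2\}$. The Fibonacci code $F_{l,h}$ has one bit and one check at each site of the periodic grid $\mathbb Z_l\times\mathbb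 Z_h$; the check at $(i,j)$ is the parity of the bits at $(i-1,j),(i,j),(i+1,j),(i,j+1)$. The repetition code of length $D$ is taken with its $D-1$ nearest-neighbour checks. The hypergraph product of $H_1$ ($r_1\times n_1$) and $H_2$ ($r_2\times n_2$) is the stabilizer code with $H_X=(H_1\otimes I_{n_2}\mid I_{r_1}\otimes H_2^T)$ and $H_Z=(I_{n_1}\otimes H_2\mid H_1^T\otimes I_{r_2})$. Let $Q_{l,h,D}$ be the hypergraph product of $F_{l,h}$ and the repetition code of length $D$. Then there are constants $R\in\mathbb N$ and $c,C>0$ such that, for all such $l,h$: 1. $F_{l,h}$ is geometrically local in 2D with range $R$, every check has weight exactly $4$, and it has parameters $[lh,\,l,\,d_1]$ with $lh\le C\,l^2$ and $d_1\ge l$; so it is an $[O(l^2),O(l),\Omega(l)]$ code. 2. For every $D\ge2$, $Q_{l,h,D}$ is a stabilizer code with parameters $[[\,lhD+lh(D-1),\ l,\ \min(d_1,D)\,]]$, $d_x=D$, $d_z=d_1$, check weight $6$, qubit-use count $6$, $q_x=q_z=4$, and it is geometrically local in 3D with range $R$. 3. If the length is chosen as $D=d_1$, so that $d_x=d_z=d_1$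 exactly, then $Q_{l,h,D}$ is an $[[n,l,d_1]]$ code with $n\le C\,l^2d_1$ and $l\,d_1^2/n\ge c$. 4. If the length is chosen as $D=l$, matching the guaranteed linear bound $d_z=d_1\ge l$, then $Q_{l,h,D}$ is an $[[n,l,l]]$ code with $n\le C\,l^3$ and $l\cdot l^2/n\ge c$; so it is an $[[O(l^3),O(l),\Omega(l)]]$ code. In both cases $kd^2/n=\Omega(1)$. -/

import Mathlib

open scoped Kronecker

/-! Binary linear codes are given by parity-check matrices over `ZMod 2`, and stabilizer codes by
their check matrices in the symplectic representation. -/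

section Classical

variable {ρ ι : Type*} [Fintype ι]

/-- The parity-check matrix `H` defines an `[n, k, d]` code: `n` bits, `k`-dimensional null space,
and minimal Hamming weight `d` of a nonzero codeword. -/
structure IsClassicalCode (H : Matrix ρ ι (ZMod 2)) (n k d : ℕ) : Prop where
  length : Fintype.card ι = n
  dimension : Module.finrank (ZMod 2) (LinearMap.ker H.mulVecLin) = k
  distance : IsLeast {w : ℕ | ∃ x : ι → ZMod 2, H.mulVec x = 0 ∧ x ≠ 0 ∧ hammingNorm x = w} d

end Classical

section Stabilizer

variable {ρ ι : Type*} [Fintype ι]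

/-- A vector of `ι ⊕ ι → ZMod 2` represents a Pauli operator on the qubits `ι`: the left copy holds
the powers of `X`, the right copy the powers of `Z`. Two operators commute iff this vanishes. -/
def sympProd (u v : ι ⊕ ι → ZMod 2) : ZMod 2 :=
  ∑ i, (u (Sum.inl i) * v (Sum.inr i) - u (Sum.inr i) * v (Sum.inl i))

/-- The set of qubits on which a Pauli operator acts nontrivially. -/
def pauliSupport (u : ι ⊕ ι → ZMod 2) : Finset ι :=
  Finset.univ.filter fun i => u (Sum.inl i) ≠ 0 ∨ u (Sum.inr i) ≠ 0

/-- A Pauli operator that commutes with all checks of `S` but is not a product of checks. -/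
def IsLogical (S : Matrix ρ (ι ⊕ ι) (ZMod 2)) (u : ι ⊕ ι → ZMod 2) : Prop :=
  (∀ r, sympProd (S r) u = 0) ∧ u ∉ Submodule.span (ZMod 2) (Set.range fun r => S r)

/-- The rows of `S` generate the stabilizer group of an `[[n, k, d]]` code. -/
structure IsStabilizerCode (S : Matrix ρ (ι ⊕ ι) (ZMod 2)) (n k d : ℕ) : Prop where
  commute : ∀ r s, sympProd (S r) (S s) = 0
  length : Fintype.card ι = n
  dimension : S.rank + k = n
  distance : IsLeast {w : ℕ | ∃ u, IsLogical S u ∧ (pauliSupport u).card = w} d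

/-- `d` is the protection against bit flips: the minimal weight of an `X`-type logical operator. -/
def IsXDistance (S : Matrix ρ (ι ⊕ ι) (ZMod 2)) (d : ℕ) : Prop :=
  IsLeast {w : ℕ | ∃ x : ι → ZMod 2, IsLogical S (Sum.elim x 0) ∧ hammingNorm x = w} d

/-- `d` is the protection against phase flips: the minimal weight of a `Z`-type logical operator. -/
def IsZDistance (S : Matrix ρ (ι ⊕ ι) (ZMod 2)) (d : ℕ) : Prop :=
  IsLeast {w : ℕ | ∃ z : ι → ZMod 2, IsLogical S (Sum.elim 0 z) ∧ hammingNorm z = w} d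

end Stabilizer

section Weights

variable {ρ ι κ : Type*} [Fintype ρ] [Fintype ι] [Fintype κ]

/-- The check weight: the largest number of nonzero entries in a row. -/
def checkWeight (S : Matrix ρ κ (ZMod 2)) : ℕ :=
  Finset.univ.sup fun r => hammingNorm (S r)

/-- The largest number of nonzero entries in a column. -/
def columnWeight (H : Matrix ρ κ (ZMod 2)) : ℕ :=
  Finset.univ.sup fun i => hammingNorm fun r => H r i

/-- The qubit-use count: the largest total weight of the two columns belonging to one qubit. -/
def qubitUse (S : Matrix ρ (ι ⊕ ι) (ZMod 2)) : ℕ :=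
  Finset.univ.sup fun i =>
    hammingNorm (fun r => S r (Sum.inl i)) + hammingNorm (fun r => S r (Sum.inr i))

end Weights

/-- Geometric locality in `dim` dimensions with range `R`: the registers `ι` can be placed at distinct
points of the integer lattice (open boundaries, no wrap-around) such that the registers in the
support of any one check differ by at most `R` in each coordinate. -/
def IsGeometricallyLocal {ρ ι : Type*} (dim R : ℕ) (supp : ρ → Finset ι) : Prop :=
  ∃ pos : ι → Fin dim → ℤ, Function.Injective pos ∧
    ∀ r, ∀ i ∈ supp r, ∀ j ∈ supp r, ∀ a, |pos i a - pos j a| ≤ (R : ℤ)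

section HypergraphProduct

variable {ρ₁ ι₁ ρ₂ ι₂ : Type*} [DecidableEq ρ₁] [DecidableEq ι₁] [DecidableEq ρ₂] [DecidableEq ι₂]

/-- `H_X = (H₁ ⊗ I | I ⊗ H₂ᵀ)`. -/
def hgpX (H₁ : Matrix ρ₁ ι₁ (ZMod 2)) (H₂ : Matrix ρ₂ ι₂ (ZMod 2)) :
    Matrix (ρ₁ × ι₂) (ι₁ × ι₂ ⊕ ρ₁ × ρ₂) (ZMod 2) :=
  Matrix.fromCols (H₁ ⊗ₖ (1 : Matrix ι₂ ι₂ (ZMod 2))) ((1 : Matrix ρ₁ ρ₁ (ZMod 2)) ⊗ₖ H₂.transpose)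

/-- `H_Z = (I ⊗ H₂ | H₁ᵀ ⊗ I)`. -/
def hgpZ (H₁ : Matrix ρ₁ ι₁ (ZMod 2)) (H₂ : Matrix ρ₂ ι₂ (ZMod 2)) :
    Matrix (ι₁ × ρ₂) (ι₁ × ι₂ ⊕ ρ₁ × ρ₂) (ZMod 2) :=
  Matrix.fromCols ((1 : Matrix ι₁ ι₁ (ZMod 2)) ⊗ₖ H₂) (H₁.transpose ⊗ₖ (1 : Matrix ρ₂ ρ₂ (ZMod 2)))

/-- The hypergraph product code in the symplectic representation: `X`-checks from `H_X`, `Z`-checks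
from `H_Z`. -/
def hgp (H₁ : Matrix ρ₁ ι₁ (ZMod 2)) (H₂ : Matrix ρ₂ ι₂ (ZMod 2)) :
    Matrix (ρ₁ × ι₂ ⊕ ι₁ × ρ₂) ((ι₁ × ι₂ ⊕ ρ₁ × ρ₂) ⊕ (ι₁ × ι₂ ⊕ ρ₁ × ρ₂)) (ZMod 2) :=
  Matrix.fromBlocks (hgpX H₁ H₂) 0 0 (hgpZ H₁ H₂)

end HypergraphProduct

/-- The Fibonacci code on the periodic `w × h` grid: bits and checks sit on the grid sites, and the
check at `(i, j)` is the parity of the bits `(i - 1, j)`, `(i, j)`, `(i + 1, j)` and `(i, j + 1)`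
(that is, the translates of `x⁻¹ + 1 + x + y`). -/
def fibonacciCheck (w h : ℕ) : Matrix (ZMod w × ZMod h) (ZMod w × ZMod h) (ZMod 2) :=
  Matrix.of fun r =>
    Pi.single (r.1 - 1, r.2) 1 + Pi.single (r.1, r.2) 1 + Pi.single (r.1 + 1, r.2) 1
      + Pi.single (r.1, r.2 + 1) 1

/-- The repetition code of length `D` with its `D - 1` nearest-neighbour checks. -/
def repetitionCheck (D : ℕ) : Matrix (Fin (D - 1)) (Fin D) (ZMod 2) :=
  Matrix.of fun i j => if j.val = i.val ∨ j.val = i.val + 1 then 1 else 0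

/-- The hypergraph product of the `w × h` Fibonacci code with the length-`D` repetition code. -/
def fibonacciHGP (w h D : ℕ) :
    Matrix ((ZMod w × ZMod h) × Fin D ⊕ (ZMod w × ZMod h) × Fin (D - 1))
      (((ZMod w × ZMod h) × Fin D ⊕ (ZMod w × ZMod h) × Fin (D - 1)) ⊕
        ((ZMod w × ZMod h) × Fin D ⊕ (ZMod w × ZMod h) × Fin (D - 1))) (ZMod 2) :=
  hgp (fibonacciCheck w h) (repetitionCheck D)

/-! The Fibonacci code is a linear cellular automaton: each row of a codeword is the image of the
previous one under `fibonacciStep`, multiplication by `x⁻¹ + 1 + x`. By Frobenius its `2 ^ n`-th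
power is `x^(-2 ^ n) + 1 + x^(2 ^ n)`, which is the identity once the two shifts coincide. Hence for
`h = l` and `h = l / 2` every first row extends to exactly one codeword, and the dimension is `l`.
In a nonzero codeword no row vanishes, the parity of the row weight is conserved, and a row of
weight one is followed by one of weight at least three. So consecutive rows have total weight at
least four, which gives distance at least `2 * h ≥ l` (`two_mul_le_hammingNorm`).

For the product of any code with a repetition code, the relations among the checks are those among
the rows of `H` (`kerVecMulHgpEquiv`), which gives the rank. A logical `Z` is detected by the sum of
its layers, a codeword of `H`, so `d_z` is the classical distance. A logical `X` is nonzero on all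
`D` layers, so `d_x = D`. Locality without wrap-around comes from folding each cycle flat onto a
line. -/

set_option linter.unusedSectionVars false

open Matrix in
/-- The row span of a matrix consists of the combinations of its rows. -/
theorem mem_span_rows_iff {ρ κ : Type*} [Fintype ρ] (S : Matrix ρ κ (ZMod 2)) (u : κ → ZMod 2) :
    u ∈ Submodule.span (ZMod 2) (Set.range fun r => S r) ↔ ∃ y, y ᵥ* S = u := by
  have h : Submodule.span (ZMod 2) (Set.range fun r => S r) = LinearMap.range S.vecMulLinear :=
    (range_vecMulLinear S).symm
  rw [h, LinearMap.mem_range]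
  rfl

/-! ### Logical operators and distance of CSS codes -/

section CSS

open Matrix

variable {ρX ρZ ι : Type*} [Fintype ι] (HX : Matrix ρX ι (ZMod 2)) (HZ : Matrix ρZ ι (ZMod 2))

theorem css_commute_iff (x z : ι → ZMod 2) :
    (∀ r, sympProd (fromBlocks HX 0 0 HZ r) (Sum.elim x z) = 0) ↔ HZ *ᵥ x = 0 ∧ HX *ᵥ z = 0 := by
  simp only [sympProd, Sum.forall, funext_iff, mulVec, dotProduct]
  simp [fromBlocks, and_comm]

theorem css_mem_span_iff [Fintype ρX] [Fintype ρZ] (x z : ι → ZMod 2) :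
    Sum.elim x z ∈ Submodule.span (ZMod 2) (Set.range fun r => fromBlocks HX 0 0 HZ r) ↔
      (∃ y, y ᵥ* HX = x) ∧ ∃ y, y ᵥ* HZ = z := by
  rw [mem_span_rows_iff]
  constructor
  · rintro ⟨y, hy⟩
    rw [vecMul_fromBlocks] at hy
    refine ⟨⟨y ∘ Sum.inl, ?_⟩, ⟨y ∘ Sum.inr, ?_⟩⟩
    · simpa using congrArg (· ∘ Sum.inl) hy
    · simpa using congrArg (· ∘ Sum.inr) hy
  · rintro ⟨⟨y, rfl⟩, ⟨y', rfl⟩⟩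
    exact ⟨Sum.elim y y', by simp [vecMul_fromBlocks]⟩

theorem css_isLogical_iff [Fintype ρX] [Fintype ρZ] (x z : ι → ZMod 2) :
    IsLogical (fromBlocks HX 0 0 HZ) (Sum.elim x z) ↔
      (HZ *ᵥ x = 0 ∧ HX *ᵥ z = 0) ∧ ((¬∃ y, y ᵥ* HX = x) ∨ ¬∃ y, y ᵥ* HZ = z) := by
  rw [IsLogical, css_commute_iff, css_mem_span_iff, not_and_or]

theorem css_isLogical_X_iff [Fintype ρX] [Fintype ρZ] (x : ι → ZMod 2) :
    IsLogical (fromBlocks HX 0 0 HZ) (Sum.elim x 0) ↔ HZ *ᵥ x = 0 ∧ ¬∃ y, y ᵥ* HX = x := by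
  have : ∃ y, y ᵥ* HZ = 0 := ⟨0, by simp⟩
  rw [css_isLogical_iff]
  simp only [mulVec_zero, this]
  tauto

theorem css_isLogical_Z_iff [Fintype ρX] [Fintype ρZ] (z : ι → ZMod 2) :
    IsLogical (fromBlocks HX 0 0 HZ) (Sum.elim 0 z) ↔ HX *ᵥ z = 0 ∧ ¬∃ y, y ᵥ* HZ = z := by
  have : ∃ y, y ᵥ* HX = 0 := ⟨0, by simp⟩
  rw [css_isLogical_iff]
  simp only [mulVec_zero, this]
  tauto

theorem hammingNorm_le_card_pauliSupport_X (x z : ι → ZMod 2) :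
    hammingNorm x ≤ (pauliSupport (Sum.elim x z)).card :=
  Finset.card_le_card fun _ hi =>
    Finset.mem_filter.2 ⟨Finset.mem_univ _, Or.inl (Finset.mem_filter.1 hi).2⟩

theorem hammingNorm_le_card_pauliSupport_Z (x z : ι → ZMod 2) :
    hammingNorm z ≤ (pauliSupport (Sum.elim x z)).card :=
  Finset.card_le_card fun _ hi =>
    Finset.mem_filter.2 ⟨Finset.mem_univ _, Or.inr (Finset.mem_filter.1 hi).2⟩

/-- The distance of a CSS code is the smaller one of its `X`- and `Z`-distances. -/
theorem css_distance [Fintype ρX] [Fintype ρZ] {dx dz : ℕ}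
    (hx : IsXDistance (fromBlocks HX 0 0 HZ) dx) (hz : IsZDistance (fromBlocks HX 0 0 HZ) dz) :
    IsLeast {w : ℕ | ∃ u, IsLogical (fromBlocks HX 0 0 HZ) u ∧ (pauliSupport u).card = w}
      (min dz dx) := by
  constructor
  · rcases min_choice dz dx with h | h <;> rw [h]
    · obtain ⟨z, hz', rfl⟩ := hz.1
      exact ⟨_, hz', by simp [pauliSupport, hammingNorm]⟩
    · obtain ⟨x, hx', rfl⟩ := hx.1
      exact ⟨_, hx', by simp [pauliSupport, hammingNorm]⟩
  · rintro _ ⟨u, hu, rfl⟩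
    obtain ⟨x, z, rfl⟩ : ∃ x z, u = Sum.elim x z :=
      ⟨u ∘ Sum.inl, u ∘ Sum.inr, (Sum.elim_comp_inl_inr u).symm⟩
    rw [css_isLogical_iff] at hu
    rcases hu with ⟨⟨h1, h2⟩, h | h⟩
    · exact (min_le_right _ _).trans <|
        (hx.2 ⟨x, (css_isLogical_X_iff HX HZ x).2 ⟨h1, h⟩, rfl⟩).trans
          (hammingNorm_le_card_pauliSupport_X x z)
    · exact (min_le_left _ _).trans <|
        (hz.2 ⟨z, (css_isLogical_Z_iff HX HZ z).2 ⟨h2, h⟩, rfl⟩).trans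
          (hammingNorm_le_card_pauliSupport_Z x z)

end CSS

/-! ### Block formulas and commutation for hypergraph products -/

section HypergraphProduct

open Matrix

variable {ρ₁ ι₁ ρ₂ ι₂ : Type*} [DecidableEq ρ₁] [DecidableEq ι₁] [DecidableEq ρ₂] [DecidableEq ι₂]
  (H₁ : Matrix ρ₁ ι₁ (ZMod 2)) (H₂ : Matrix ρ₂ ι₂ (ZMod 2))

theorem hgpX_mulVec [Fintype ρ₁] [Fintype ι₁] [Fintype ρ₂] [Fintype ι₂]
    (z : ι₁ × ι₂ ⊕ ρ₁ × ρ₂ → ZMod 2) (r : ρ₁) (k : ι₂) :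
    (hgpX H₁ H₂ *ᵥ z) (r, k) =
      (H₁ *ᵥ fun i => z (Sum.inl (i, k))) r + ((fun a => z (Sum.inr (r, a))) ᵥ* H₂) k := by
  simp [hgpX, mulVec, vecMul, dotProduct, Fintype.sum_prod_type, one_apply, kroneckerMap_apply,
    mul_comm, ite_mul, mul_ite]

theorem hgpZ_mulVec [Fintype ρ₁] [Fintype ι₁] [Fintype ρ₂] [Fintype ι₂]
    (x : ι₁ × ι₂ ⊕ ρ₁ × ρ₂ → ZMod 2) (i : ι₁) (a : ρ₂) :
    (hgpZ H₁ H₂ *ᵥ x) (i, a) =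
      (H₂ *ᵥ fun k => x (Sum.inl (i, k))) a + ((fun r => x (Sum.inr (r, a))) ᵥ* H₁) i := by
  simp [hgpZ, mulVec, vecMul, dotProduct, Fintype.sum_prod_type, one_apply, kroneckerMap_apply,
    mul_comm, ite_mul, mul_ite]

theorem vecMul_hgpX_inl [Fintype ρ₁] [Fintype ι₂] (y : ρ₁ × ι₂ → ZMod 2) (i : ι₁) (k : ι₂) :
    (y ᵥ* hgpX H₁ H₂) (Sum.inl (i, k)) = ((fun r => y (r, k)) ᵥ* H₁) i := by
  simp [hgpX, vecMul, dotProduct, Fintype.sum_prod_type, one_apply, kroneckerMap_apply]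

theorem vecMul_hgpX_inr [Fintype ρ₁] [Fintype ι₂] (y : ρ₁ × ι₂ → ZMod 2) (r : ρ₁) (a : ρ₂) :
    (y ᵥ* hgpX H₁ H₂) (Sum.inr (r, a)) = (H₂ *ᵥ fun k => y (r, k)) a := by
  simp [hgpX, mulVec, vecMul, dotProduct, Fintype.sum_prod_type, one_apply, kroneckerMap_apply,
    mul_comm]

theorem vecMul_hgpZ_inl [Fintype ι₁] [Fintype ρ₂] (y : ι₁ × ρ₂ → ZMod 2) (i : ι₁) (k : ι₂) :
    (y ᵥ* hgpZ H₁ H₂) (Sum.inl (i, k)) = ((fun a => y (i, a)) ᵥ* H₂) k := by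
  simp [hgpZ, vecMul, dotProduct, Fintype.sum_prod_type, one_apply, kroneckerMap_apply]

/-- Both blocks contribute `H₁ ⊗ H₂ᵀ`, and the two copies cancel in characteristic two. -/
theorem hgpX_mul_hgpZ_transpose [Fintype ρ₁] [Fintype ι₁] [Fintype ρ₂] [Fintype ι₂] :
    hgpX H₁ H₂ * (hgpZ H₁ H₂)ᵀ = 0 := by
  ext ⟨r, k⟩ ⟨i, a⟩
  simp [hgpX, hgpZ, mul_apply, Fintype.sum_prod_type, one_apply, kroneckerMap_apply,
    mul_comm, CharTwo.add_self_eq_zero]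

/-- The checks of a hypergraph product commute. -/
theorem hgp_commute [Fintype ρ₁] [Fintype ι₁] [Fintype ρ₂] [Fintype ι₂]
    (r s : ρ₁ × ι₂ ⊕ ι₁ × ρ₂) : sympProd (hgp H₁ H₂ r) (hgp H₁ H₂ s) = 0 := by
  have key : hgpZ H₁ H₂ * (hgpX H₁ H₂)ᵀ = 0 := by
    rw [← transpose_transpose (hgpZ H₁ H₂), ← transpose_mul, hgpX_mul_hgpZ_transpose,
      transpose_zero]
  have hs : hgp H₁ H₂ s = Sum.elim (fun i => hgp H₁ H₂ s (Sum.inl i))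
      (fun i => hgp H₁ H₂ s (Sum.inr i)) := by
    ext (_ | _) <;> rfl
  rw [hs]
  refine (css_commute_iff _ _ _ _).2 ?_ r
  rcases s with s | s
  · exact ⟨funext fun t => congrFun (congrFun key t) s, mulVec_zero _⟩
  · exact ⟨mulVec_zero _, funext fun t => congrFun (congrFun (hgpX_mul_hgpZ_transpose H₁ H₂) t) s⟩

end HypergraphProduct

/-! ### Row and column weights of hypergraph products -/

section HammingNorm

open Matrix

variable {α β : Type*} [Fintype α] [Fintype β]

theorem hammingNorm_sum (f : α ⊕ β → ZMod 2) :
    hammingNorm f = hammingNorm (fun a => f (Sum.inl a)) + hammingNorm (fun b => f (Sum.inr b)) := by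
  simp only [hammingNorm, Finset.card_filter, Fintype.sum_sum_type]

theorem hammingNorm_prod (f : α × β → ZMod 2) :
    hammingNorm f = ∑ b, hammingNorm (fun a => f (a, b)) := by
  simp only [hammingNorm, Finset.card_filter, Fintype.sum_prod_type_right]

theorem hammingNorm_mul_one [DecidableEq β] (f : α → ZMod 2) (b : β) :
    hammingNorm (fun p : α × β => f p.1 * (1 : Matrix β β (ZMod 2)) b p.2) = hammingNorm f := by
  rw [hammingNorm_prod, Finset.sum_eq_single b]
  · simp
  · intro c _ hc
    simp [one_apply_ne hc.symm, hammingNorm]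
  · simp

theorem hammingNorm_one_mul [DecidableEq α] (f : β → ZMod 2) (a : α) :
    hammingNorm (fun p : α × β => (1 : Matrix α α (ZMod 2)) a p.1 * f p.2) = hammingNorm f := by
  rw [← hammingNorm_mul_one f a]
  exact Finset.card_equiv (Equiv.prodComm α β) (by rintro ⟨_, _⟩; simp [mul_comm])

variable {ρ₁ ι₁ ρ₂ ι₂ : Type*} [DecidableEq ρ₁] [DecidableEq ι₁] [DecidableEq ρ₂] [DecidableEq ι₂]
  [Fintype ρ₁] [Fintype ι₁] [Fintype ρ₂] [Fintype ι₂]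
  (H₁ : Matrix ρ₁ ι₁ (ZMod 2)) (H₂ : Matrix ρ₂ ι₂ (ZMod 2))

theorem hammingNorm_hgpX_row (r : ρ₁) (k : ι₂) :
    hammingNorm (hgpX H₁ H₂ (r, k)) = hammingNorm (H₁ r) + hammingNorm fun a => H₂ a k := by
  rw [hammingNorm_sum, ← hammingNorm_mul_one (H₁ r) k, ← hammingNorm_one_mul (fun a => H₂ a k) r]
  rfl

theorem hammingNorm_hgpZ_row (i : ι₁) (a : ρ₂) :
    hammingNorm (hgpZ H₁ H₂ (i, a)) = hammingNorm (H₂ a) + hammingNorm fun r => H₁ r i := by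
  rw [hammingNorm_sum, ← hammingNorm_mul_one (fun r => H₁ r i) a, ← hammingNorm_one_mul (H₂ a) i]
  rfl

theorem hammingNorm_hgpX_col_inl (i : ι₁) (k : ι₂) :
    hammingNorm (fun s => hgpX H₁ H₂ s (Sum.inl (i, k))) = hammingNorm fun r => H₁ r i := by
  rw [← hammingNorm_mul_one (fun r => H₁ r i) k]
  simp [hgpX, kroneckerMap_apply, one_apply, eq_comm]

theorem hammingNorm_hgpX_col_inr (r : ρ₁) (a : ρ₂) :
    hammingNorm (fun s => hgpX H₁ H₂ s (Sum.inr (r, a))) = hammingNorm (H₂ a) := by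
  rw [← hammingNorm_one_mul (H₂ a) r]
  simp [hgpX, kroneckerMap_apply, one_apply, eq_comm]

theorem hammingNorm_hgpZ_col_inl (i : ι₁) (k : ι₂) :
    hammingNorm (fun s => hgpZ H₁ H₂ s (Sum.inl (i, k))) = hammingNorm fun a => H₂ a k := by
  rw [← hammingNorm_one_mul (fun a => H₂ a k) i]
  simp [hgpZ, kroneckerMap_apply, one_apply, eq_comm]

theorem hammingNorm_hgpZ_col_inr (r : ρ₁) (a : ρ₂) :
    hammingNorm (fun s => hgpZ H₁ H₂ s (Sum.inr (r, a))) = hammingNorm (H₁ r) := by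
  rw [← hammingNorm_mul_one (H₁ r) a]
  simp [hgpZ, kroneckerMap_apply, one_apply, eq_comm]

theorem hammingNorm_hgp_row_inl (s : ρ₁ × ι₂) :
    hammingNorm (hgp H₁ H₂ (Sum.inl s)) = hammingNorm (hgpX H₁ H₂ s) := by
  rw [hammingNorm_sum]
  exact congrArg (hammingNorm (hgpX H₁ H₂ s) + ·) hammingNorm_zero

theorem hammingNorm_hgp_row_inr (s : ι₁ × ρ₂) :
    hammingNorm (hgp H₁ H₂ (Sum.inr s)) = hammingNorm (hgpZ H₁ H₂ s) := by
  rw [hammingNorm_sum]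
  exact (congrArg (· + hammingNorm (hgpZ H₁ H₂ s)) hammingNorm_zero).trans (Nat.zero_add _)

theorem hammingNorm_hgp_col_inl (q : ι₁ × ι₂ ⊕ ρ₁ × ρ₂) :
    hammingNorm (fun s => hgp H₁ H₂ s (Sum.inl q)) = hammingNorm fun s => hgpX H₁ H₂ s q := by
  rw [hammingNorm_sum]
  exact congrArg ((hammingNorm fun s => hgpX H₁ H₂ s q) + ·) hammingNorm_zero

theorem hammingNorm_hgp_col_inr (q : ι₁ × ι₂ ⊕ ρ₁ × ρ₂) :
    hammingNorm (fun s => hgp H₁ H₂ s (Sum.inr q)) = hammingNorm fun s => hgpZ H₁ H₂ s q := by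
  rw [hammingNorm_sum]
  exact (congrArg (· + (hammingNorm fun s => hgpZ H₁ H₂ s q)) hammingNorm_zero).trans
    (Nat.zero_add _)

end HammingNorm

/-! ### The repetition code as discrete calculus on a path -/

section Repetition

open Matrix

variable {D : ℕ}

/-- The first bit of a check of the repetition code. -/
def repLeft (a : Fin (D - 1)) : Fin D := ⟨a, by omega⟩

/-- The second bit of a check of the repetition code. -/
def repRight (a : Fin (D - 1)) : Fin D := ⟨a + 1, by omega⟩

theorem repLeft_ne_repRight (a : Fin (D - 1)) : repLeft a ≠ repRight a := by
  simp [repLeft, repRight]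

theorem repetitionCheck_ne_zero_iff (a : Fin (D - 1)) (k : Fin D) :
    repetitionCheck D a k ≠ 0 ↔ k = repLeft a ∨ k = repRight a := by
  simp only [repetitionCheck, repLeft, repRight, Fin.ext_iff, of_apply]
  split_ifs with h <;> simp [h]

theorem repetitionCheck_mulVec (f : Fin D → ZMod 2) (a : Fin (D - 1)) :
    (repetitionCheck D *ᵥ f) a = f (repLeft a) + f (repRight a) := by
  rw [mulVec, dotProduct, Fintype.sum_eq_add _ _ (repLeft_ne_repRight a)]
  · simp [repetitionCheck, repLeft, repRight]
  · intro k hk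
    have := (repetitionCheck_ne_zero_iff a k).not.2 (by tauto)
    rw [not_not.1 this, zero_mul]

/-- Check `a` joins bits `a` and `a + 1` and carries the value `G (a + 1)`. Padding with zeros at
`0` and `D` makes the formula uniform at the two end bits, which lie in fewer checks. -/
theorem vecMul_repetitionCheck (G : ℕ → ZMod 2) (h0 : G 0 = 0) (hD : G D = 0) (k : Fin D) :
    ((fun a : Fin (D - 1) => G (a + 1)) ᵥ* repetitionCheck D) k = G k + G (k + 1) := by
  obtain ⟨E, rfl⟩ : ∃ E, D = E + 1 := ⟨D - 1, by have := k.2; omega⟩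
  have h1 : ((fun a : Fin (E + 1 - 1) => G (a + 1)) ᵥ* repetitionCheck (E + 1)) k
      = ∑ i ∈ Finset.range E, G (i + 1) * if k.val = i ∨ k.val = i + 1 then 1 else 0 := by
    rw [Finset.sum_range]
    rfl
  have h2 : ∀ i, (G (i + 1) * if k.val = i ∨ k.val = i + 1 then (1 : ZMod 2) else 0) =
      (if k.val = i then G (i + 1) else 0) + if k.val = i + 1 then G (i + 1) else 0 := by
    intro i
    by_cases h : k.val = i
    · simp [h]
    · simp [h]
  rw [h1, Finset.sum_congr rfl fun i _ => h2 i, Finset.sum_add_distrib]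
  rcases k with ⟨k, hk⟩
  have e1 : ∑ i ∈ Finset.range E, (if k = i then G (i + 1) else 0) = G (k + 1) := by
    rw [Finset.sum_ite_eq]
    split_ifs with h
    · rfl
    · rw [Finset.mem_range] at h
      rw [show k + 1 = E + 1 by omega, hD]
  have e2 : ∑ i ∈ Finset.range E, (if k = i + 1 then G (i + 1) else 0) = G k := by
    rcases k with _ | k
    · simp [h0]
    · simp only [Nat.add_right_cancel_iff]
      rw [Finset.sum_ite_eq, if_pos (by simp; omega)]
  rw [e1, e2, add_comm]

theorem vecMul_repetitionCheck_eq_zero (y : Fin (D - 1) → ZMod 2)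
    (hy : y ᵥ* repetitionCheck D = 0) : y = 0 := by
  set G : ℕ → ZMod 2 := fun n => if h : 0 < n ∧ n < D then y ⟨n - 1, by omega⟩ else 0 with hG
  have hyG : y = fun a : Fin (D - 1) => G (a + 1) := by
    ext a
    have : a.val + 1 < D := by omega
    simp [hG, this]
  have hstep : ∀ k, k < D → G k = G (k + 1) := by
    intro k hk
    have h := congrFun hy ⟨k, hk⟩
    rw [hyG, vecMul_repetitionCheck G (by simp [hG]) (by simp [hG])] at h
    exact CharTwo.add_eq_zero.1 h
  have hzero : ∀ k, k ≤ D → G k = 0 := by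
    intro k
    induction k with
    | zero => intro _; simp [hG]
    | succ k ih => intro hk; rw [← hstep k (by omega), ih (by omega)]
  rw [hyG]
  ext a
  exact hzero _ (by omega)

/-- The preimage is the sequence of partial sums of `f`; the vanishing total is the boundary
condition at `D`. -/
theorem exists_vecMul_repetitionCheck_eq (f : Fin D → ZMod 2) (hf : ∑ k, f k = 0) :
    ∃ y, y ᵥ* repetitionCheck D = f := by
  set F : ℕ → ZMod 2 := fun n => if h : n < D then f ⟨n, h⟩ else 0 with hF
  refine ⟨fun a => ∑ i ∈ Finset.range (a + 1), F i, ?_⟩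
  ext k
  rw [vecMul_repetitionCheck (fun n => ∑ i ∈ Finset.range n, F i) (by simp)]
  · rw [Finset.sum_range_succ, ← add_assoc, CharTwo.add_self_eq_zero, zero_add]
    simp [hF]
  · rw [Finset.sum_range, ← hf]
    simp [hF]

/-- This is the pairing with the all-ones codeword. -/
theorem sum_vecMul_repetitionCheck (y : Fin (D - 1) → ZMod 2) :
    ∑ k, (y ᵥ* repetitionCheck D) k = 0 := by
  have h : repetitionCheck D *ᵥ 1 = 0 := by
    ext a
    rw [repetitionCheck_mulVec]
    exact CharTwo.add_self_eq_zero _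
  have h' := dotProduct_mulVec y (repetitionCheck D) 1
  rw [h, dotProduct_zero] at h'
  simpa [dotProduct] using h'.symm

theorem repetition_iff {P : Fin D → Prop} (hs : ∀ a, P (repLeft a) ↔ P (repRight a)) (j k : Fin D) :
    P j ↔ P k := by
  have h : ∀ k : Fin D, P k ↔ P ⟨0, by have := k.2; omega⟩ := by
    rintro ⟨k, hk⟩
    induction k with
    | zero => rfl
    | succ k ih => exact (hs ⟨k, by omega⟩).symm.trans (ih (by omega))
  rw [h j, h k]

/-- Discrete integration along the repetition code. -/
theorem exists_repRight_eq_add {M : Type*} [AddCommGroup M] (k₀ : Fin D) (y₀ : M)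
    (g : Fin (D - 1) → M) :
    ∃ y : Fin D → M, y k₀ = y₀ ∧ ∀ a, y (repRight a) = y (repLeft a) + g a := by
  -- The default `0` is never reached, since for `k < D` the sum `G k` only involves indices below
  -- `D - 1`.
  set G : ℕ → M := fun n => ∑ i ∈ Finset.range n, if h : i < D - 1 then g ⟨i, h⟩ else 0 with hG
  refine ⟨fun k => y₀ - G k₀ + G k, sub_add_cancel _ _, fun a => ?_⟩
  simp [hG, repLeft, repRight, Finset.sum_range_succ, add_assoc]

theorem eq_of_repetitionCheck_mulVec_eq_zero (f : Fin D → ZMod 2)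
    (hf : repetitionCheck D *ᵥ f = 0) (j k : Fin D) : f j = f k := by
  refine (repetition_iff (P := fun i => f j = f i) (fun a => ?_) j k).1 rfl
  have := congrFun hf a
  rw [repetitionCheck_mulVec] at this
  rw [CharTwo.add_eq_zero.1 this]

theorem hammingNorm_repetitionCheck_row (a : Fin (D - 1)) :
    hammingNorm (repetitionCheck D a) = 2 := by
  refine (congrArg Finset.card ?_).trans (Finset.card_pair (repLeft_ne_repRight a))
  ext k
  simpa using repetitionCheck_ne_zero_iff a k

theorem hammingNorm_repetitionCheck_col_le (k : Fin D) :
    hammingNorm (fun a => repetitionCheck D a k) ≤ 2 := by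
  -- Bit `k` lies at most in checks `k` and `k - 1`; at `k = 0` the truncated subtraction merely
  -- repeats an element.
  refine (Finset.card_le_card_of_injOn (t := {k.val, k.val - 1}) (fun a => a.val) ?_ ?_).trans
    Finset.card_le_two
  · intro a ha
    have := (repetitionCheck_ne_zero_iff a k).1 (by simpa using ha)
    simp only [repLeft, repRight, Fin.ext_iff] at this
    simp
    omega
  · intro a _ b _ h
    exact Fin.ext h

end Repetition

/-! ### Product of an arbitrary code with a repetition code -/

section Product

open Matrix

variable {ρ ι : Type*} [Fintype ρ] [Fintype ι] [DecidableEq ρ] [DecidableEq ι]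
  (H : Matrix ρ ι (ZMod 2)) {D : ℕ}

theorem mem_ker_transpose_hgp_iff {ρ₂ ι₂ : Type*} [Fintype ρ₂] [Fintype ι₂] [DecidableEq ρ₂]
    [DecidableEq ι₂] (H₂ : Matrix ρ₂ ι₂ (ZMod 2)) (y : ρ × ι₂ ⊕ ι × ρ₂ → ZMod 2) :
    y ∈ LinearMap.ker (hgp H H₂)ᵀ.mulVecLin ↔
      (fun p => y (Sum.inl p)) ᵥ* hgpX H H₂ = 0 ∧ (fun p => y (Sum.inr p)) ᵥ* hgpZ H H₂ = 0 := by
  rw [LinearMap.mem_ker, mulVecLin_apply, mulVec_transpose]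
  unfold hgp
  rw [vecMul_fromBlocks, vecMul_zero, vecMul_zero, add_zero, zero_add, ← Sum.elim_zero_zero,
    Sum.elim_eq_iff]
  rfl

/-- The kernel of the transposed product is the kernel of the transposed first factor. -/
def kerVecMulHgpEquiv (hD : 0 < D) :
    LinearMap.ker Hᵀ.mulVecLin ≃ₗ[ZMod 2] LinearMap.ker (hgp H (repetitionCheck D))ᵀ.mulVecLin where
  toFun f := ⟨Sum.elim (fun p => f.1 p.1) 0, by
    have hf : f.1 ᵥ* H = 0 := by
      rw [← mulVec_transpose]
      exact f.2
    refine (mem_ker_transpose_hgp_iff H _ _).2 ⟨?_, zero_vecMul _⟩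
    ext (⟨i, k⟩ | ⟨r, a⟩)
    · rw [vecMul_hgpX_inl]
      exact congrFun hf i
    · rw [vecMul_hgpX_inr, repetitionCheck_mulVec]
      exact CharTwo.add_self_eq_zero _⟩
  invFun y := ⟨fun r => y.1 (Sum.inl (r, ⟨0, hD⟩)), by
    have hy := ((mem_ker_transpose_hgp_iff H _ _).1 y.2).1
    rw [LinearMap.mem_ker, mulVecLin_apply, mulVec_transpose]
    ext i
    rw [← vecMul_hgpX_inl H (repetitionCheck D) (fun p => y.1 (Sum.inl p)), hy]
    rfl⟩
  left_inv f := rfl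
  right_inv y := by
    obtain ⟨y, hy⟩ := y
    obtain ⟨hy1, hy2⟩ := (mem_ker_transpose_hgp_iff H _ _).1 hy
    refine Subtype.ext (funext ?_)
    rintro (⟨r, k⟩ | ⟨i, a⟩)
    · refine eq_of_repetitionCheck_mulVec_eq_zero (fun k => y (Sum.inl (r, k))) ?_ _ _
      ext a
      rw [← vecMul_hgpX_inr H (repetitionCheck D) (fun p => y (Sum.inl p)), hy1]
      rfl
    · have h : (fun a => y (Sum.inr (i, a))) = 0 := by
        refine vecMul_repetitionCheck_eq_zero _ ?_
        ext k
        rw [← vecMul_hgpZ_inl H (repetitionCheck D) (fun p => y (Sum.inr p)), hy2]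
        rfl
      exact (congrFun h a).symm
  map_add' f g := Subtype.ext (by ext (_ | _) <;> simp)
  map_smul' c f := Subtype.ext (by ext (_ | _) <;> simp)

theorem rank_add_finrank_ker {α β : Type*} [Fintype α] [Fintype β] (A : Matrix α β (ZMod 2)) :
    A.rank + Module.finrank (ZMod 2) (LinearMap.ker A.mulVecLin) = Fintype.card β := by
  have := A.mulVecLin.finrank_range_add_finrank_ker
  rwa [Module.finrank_fintype_fun_eq_card] at this

/-- Rank-nullity is applied to the transposed product, to `Hᵀ` and to `H`; the first two kernels
have equal dimension by `kerVecMulHgpEquiv`. -/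
theorem rank_hgp_repetition (hD : 0 < D) :
    (hgp H (repetitionCheck D)).rank + Module.finrank (ZMod 2) (LinearMap.ker H.mulVecLin) =
      Fintype.card ι * D + Fintype.card ρ * (D - 1) := by
  have h1 := rank_add_finrank_ker (hgp H (repetitionCheck D))ᵀ
  have h2 := rank_add_finrank_ker Hᵀ
  have h3 := rank_add_finrank_ker H
  rw [rank_transpose] at h1 h2
  rw [← (kerVecMulHgpEquiv H hD).finrank_eq] at h1
  simp only [Fintype.card_sum, Fintype.card_prod, Fintype.card_fin] at h1
  obtain ⟨E, rfl⟩ : ∃ E, D = E + 1 := ⟨D - 1, by omega⟩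
  simp only [Nat.add_sub_cancel, Nat.mul_add, Nat.mul_one] at h1 ⊢
  omega

/-- A `Z`-type operator that commutes with the `X`-checks and whose layers add up to zero is a product
of `Z`-checks. -/
theorem hgpZ_exists_of_sum_eq_zero (z : ι × Fin D ⊕ ρ × Fin (D - 1) → ZMod 2)
    (hz : hgpX H (repetitionCheck D) *ᵥ z = 0) (hs : ∀ i, ∑ k, z (Sum.inl (i, k)) = 0) :
    ∃ y, y ᵥ* hgpZ H (repetitionCheck D) = z := by
  -- Each column along the repetition direction has zero sum, so it is integrated separately. This
  -- fixes the first block; the second is then forced because the transposed repetition check is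
  -- injective.
  choose y hy using fun i => exists_vecMul_repetitionCheck_eq _ (hs i)
  refine ⟨fun p => y p.1 p.2, ?_⟩
  have h0 : hgpX H (repetitionCheck D) *ᵥ
      ((fun p : ι × Fin (D - 1) => y p.1 p.2) ᵥ* hgpZ H (repetitionCheck D)) = 0 := by
    rw [← mulVec_transpose, mulVec_mulVec, hgpX_mul_hgpZ_transpose, zero_mulVec]
  set w := (fun p : ι × Fin (D - 1) => y p.1 p.2) ᵥ* hgpZ H (repetitionCheck D) with hw
  have hinl : ∀ i k, w (Sum.inl (i, k)) = z (Sum.inl (i, k)) := fun i k => by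
    rw [hw, vecMul_hgpZ_inl, hy]
  ext (⟨i, k⟩ | ⟨r, a⟩)
  · exact hinl i k
  · have hd : (fun a => w (Sum.inr (r, a)) - z (Sum.inr (r, a))) = 0 := by
      refine vecMul_repetitionCheck_eq_zero _ ?_
      ext k
      have e1 := congrFun h0 (r, k)
      have e2 := congrFun hz (r, k)
      rw [hgpX_mulVec] at e1 e2
      simp only [hinl] at e1
      have := (e1.trans e2.symm)
      rw [add_right_inj] at this
      rw [show (fun a => w (Sum.inr (r, a)) - z (Sum.inr (r, a))) =
        (fun a => w (Sum.inr (r, a))) - fun a => z (Sum.inr (r, a)) from rfl, sub_vecMul,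
        Pi.sub_apply, this, sub_self]
      rfl
    exact sub_eq_zero.1 (congrFun hd a)

/-- An `X`-type operator that commutes with the `Z`-checks and has a layer that is a combination of
rows of `H` is a product of `X`-checks. -/
theorem hgpX_exists_of_layer (x : ι × Fin D ⊕ ρ × Fin (D - 1) → ZMod 2)
    (hx : hgpZ H (repetitionCheck D) *ᵥ x = 0) (k₀ : Fin D)
    (hk : ∃ y, y ᵥ* H = fun i => x (Sum.inl (i, k₀))) :
    ∃ y, y ᵥ* hgpX H (repetitionCheck D) = x := by
  obtain ⟨y₀, hy₀⟩ := hk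
  -- Integrating the second block of `x` from `y₀` makes that block correct by construction. The
  -- `Z`-checks carry the first block from layer `k₀` to all others.
  obtain ⟨y, hyk, hy⟩ := exists_repRight_eq_add k₀ y₀ (fun a r => x (Sum.inr (r, a)))
  have hlayer : ∀ k, y k ᵥ* H = fun i => x (Sum.inl (i, k)) := by
    intro k
    refine (repetition_iff (P := fun k => y k ᵥ* H = fun i => x (Sum.inl (i, k))) (fun a => ?_)
      k₀ k).1 (by rw [hyk, hy₀])
    have hstep : (fun i => x (Sum.inl (i, repRight a))) =
        (fun i => x (Sum.inl (i, repLeft a))) + (fun r => x (Sum.inr (r, a))) ᵥ* H := by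
      ext i
      have h := congrFun hx (i, a)
      rw [hgpZ_mulVec, repetitionCheck_mulVec] at h
      rw [Pi.add_apply, ← CharTwo.add_eq_zero.1 h, ← add_assoc, CharTwo.add_self_eq_zero, zero_add]
    rw [hy, add_vecMul, hstep, add_left_inj]
  refine ⟨fun p => y p.2 p.1, ?_⟩
  ext (⟨i, k⟩ | ⟨r, a⟩)
  · rw [vecMul_hgpX_inl]
    exact congrFun (hlayer k) i
  · rw [vecMul_hgpX_inr, repetitionCheck_mulVec, hy, Pi.add_apply, ← add_assoc,
      CharTwo.add_self_eq_zero, zero_add]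

theorem hammingNorm_inl_le {α β : Type*} [Fintype α] [Fintype β] (f : α ⊕ β → ZMod 2) :
    hammingNorm (fun a => f (Sum.inl a)) ≤ hammingNorm f := by
  rw [hammingNorm_sum f]
  exact Nat.le_add_right _ _

theorem hammingNorm_sum_apply_le {α β : Type*} [Fintype α] [Fintype β] (f : α × β → ZMod 2) :
    hammingNorm (fun a => ∑ b, f (a, b)) ≤ hammingNorm f := by
  refine Finset.card_le_card_of_surjOn Prod.fst ?_
  intro a ha
  have ha' : ∑ b, f (a, b) ≠ 0 := by simpa using ha
  obtain ⟨b, -, hb⟩ := Finset.exists_ne_zero_of_sum_ne_zero ha'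
  exact ⟨(a, b), by simpa using hb, rfl⟩

/-- A minimal codeword on one layer attains the bound: layers of a product of `Z`-checks sum to
zero, but here they sum to the codeword. Conversely, the layers of a logical operator sum to a
codeword of no larger weight, nonzero by `hgpZ_exists_of_sum_eq_zero`. -/
theorem hgp_repetition_isZDistance {n k d : ℕ} (hH : IsClassicalCode H n k d) (hD : 0 < D) :
    IsZDistance (hgp H (repetitionCheck D)) d := by
  constructor
  · obtain ⟨c, hc, hc0, rfl⟩ := hH.distance.1
    refine ⟨Sum.elim (fun p => c p.1 * (1 : Matrix (Fin D) (Fin D) (ZMod 2)) ⟨0, hD⟩ p.2) 0,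
      (css_isLogical_Z_iff _ _ _).2 ⟨?_, ?_⟩, ?_⟩
    · ext ⟨r, k⟩
      rw [hgpX_mulVec]
      have h1 : (fun i => c i * (1 : Matrix (Fin D) (Fin D) (ZMod 2)) ⟨0, hD⟩ k) =
          MulOpposite.op ((1 : Matrix (Fin D) (Fin D) (ZMod 2)) ⟨0, hD⟩ k) • c := rfl
      simp only [Sum.elim_inl, Sum.elim_inr, h1, mulVec_smul, hc]
      simp [vecMul, dotProduct]
    · rintro ⟨y, hy⟩
      refine hc0 (funext fun i => ?_)
      have h := sum_vecMul_repetitionCheck fun a => y (i, a)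
      simp only [← vecMul_hgpZ_inl H, hy, Sum.elim_inl, ← Finset.mul_sum] at h
      simpa [one_apply] using h
    · rw [hammingNorm_sum]
      exact congrArg₂ (· + ·) (hammingNorm_mul_one c _) hammingNorm_zero
  · rintro _ ⟨z, hz, rfl⟩
    obtain ⟨hz, hz'⟩ := (css_isLogical_Z_iff _ _ _).1 hz
    refine (hH.distance.2 ⟨fun i => ∑ k, z (Sum.inl (i, k)), ?_, ?_, rfl⟩).trans
      ((hammingNorm_sum_apply_le fun p => z (Sum.inl p)).trans (hammingNorm_inl_le z))
    · have h : (fun i => ∑ k, z (Sum.inl (i, k))) = ∑ k, fun i => z (Sum.inl (i, k)) := by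
        ext i
        simp
      rw [h, mulVec_sum]
      ext r
      have e : ∀ k, (H *ᵥ fun i => z (Sum.inl (i, k))) r =
          ((fun a => z (Sum.inr (r, a))) ᵥ* repetitionCheck D) k := by
        intro k
        have := congrFun hz (r, k)
        rw [hgpX_mulVec] at this
        exact CharTwo.add_eq_zero.1 this
      rw [Finset.sum_apply, Finset.sum_congr rfl fun k _ => e k, sum_vecMul_repetitionCheck]
      rfl
    · intro h
      exact hz' (hgpZ_exists_of_sum_eq_zero H z hz (congrFun h))

/-- A line through all layers at a bit `b` with `c b ≠ 0` attains the bound: combinations of rows of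
`H` are orthogonal to `c`, the unit vector at `b` is not. -/
theorem hgp_repetition_isXDistance {n k d : ℕ} (hH : IsClassicalCode H n k d) (hD : 0 < D) :
    IsXDistance (hgp H (repetitionCheck D)) D := by
  constructor
  · obtain ⟨c, hc, hc0, -⟩ := hH.distance.1
    obtain ⟨b, hb⟩ := Function.ne_iff.1 hc0
    refine ⟨Sum.elim (fun p => (1 : Matrix ι ι (ZMod 2)) b p.1 * (fun _ => 1 : Fin D → ZMod 2) p.2) 0,
      (css_isLogical_X_iff _ _ _).2 ⟨?_, ?_⟩, ?_⟩
    · ext ⟨i, a⟩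
      rw [hgpZ_mulVec, repetitionCheck_mulVec]
      simp [CharTwo.add_self_eq_zero, vecMul, dotProduct]
    · rintro ⟨y, hy⟩
      have h : (fun r => y (r, ⟨0, hD⟩)) ᵥ* H = (1 : Matrix ι ι (ZMod 2)) b := by
        ext i
        rw [← vecMul_hgpX_inl H (repetitionCheck D), hy]
        simp
      have h' := dotProduct_mulVec (fun r => y (r, ⟨0, hD⟩)) H c
      rw [hc, h, dotProduct_zero] at h'
      apply hb
      simpa [dotProduct, one_apply] using h'.symm
    · rw [hammingNorm_sum]
      refine (congrArg₂ (· + ·) (hammingNorm_one_mul (fun _ => 1 : Fin D → ZMod 2) b)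
        hammingNorm_zero).trans ?_
      simp [hammingNorm]
  · rintro _ ⟨x, hx, rfl⟩
    obtain ⟨hx, hx'⟩ := (css_isLogical_X_iff _ _ _).1 hx
    refine le_trans ?_ (hammingNorm_inl_le x)
    rw [hammingNorm_prod]
    refine le_trans ?_ (Finset.card_nsmul_le_sum _ _ 1 fun k _ => ?_)
    · simp
    · rw [Nat.one_le_iff_ne_zero, hammingNorm_ne_zero_iff]
      intro h
      -- A vanishing layer is the empty combination of rows, which would make `x` trivial.
      exact hx' (hgpX_exists_of_layer H x hx k ⟨0, by rw [zero_vecMul]; exact h.symm⟩)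

/-- The parameters of the hypergraph product with a repetition code. -/
theorem hgp_repetition_isStabilizerCode {n k d : ℕ} (hH : IsClassicalCode H n k d) (hD : 0 < D) :
    IsStabilizerCode (hgp H (repetitionCheck D)) (n * D + Fintype.card ρ * (D - 1)) k (min d D) where
  commute := hgp_commute H _
  length := by simp [hH.length]
  dimension := by rw [← hH.dimension, rank_hgp_repetition H hD, hH.length]
  distance := css_distance _ _ (hgp_repetition_isXDistance H hH hD)
    (hgp_repetition_isZDistance H hH hD)

end Product

/-! ### The Fibonacci code as a cellular automaton -/

section Fibonacci

open Matrix

variable {w h : ℕ}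

/-- One row of a Fibonacci codeword determines the next one through this map. -/
def fibonacciStep (w : ℕ) : (ZMod w → ZMod 2) →ₗ[ZMod 2] ZMod w → ZMod 2 where
  toFun f := fun i => f (i - 1) + f i + f (i + 1)
  map_add' f g := by
    ext i
    simp only [Pi.add_apply]
    ring
  map_smul' c f := by
    ext i
    simp only [Pi.smul_apply, smul_eq_mul, RingHom.id_apply]
    ring

theorem fibonacciStep_apply (f : ZMod w → ZMod 2) (i : ZMod w) :
    fibonacciStep w f i = f (i - 1) + f i + f (i + 1) := rfl

/-- Frobenius for `x⁻¹ + 1 + x`: on squaring, the cross terms cancel in pairs. -/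
theorem fibonacciStep_pow_two_pow (n : ℕ) (f : ZMod w → ZMod 2) (i : ZMod w) :
    (fibonacciStep w ^ 2 ^ n) f i = f (i - (2 ^ n : ℕ)) + f i + f (i + (2 ^ n : ℕ)) := by
  induction n generalizing f i with
  | zero => simp [fibonacciStep_apply]
  | succ n ih =>
    rw [pow_succ 2 n, mul_two, pow_add, Module.End.mul_apply, ih, ih, ih, ih]
    push_cast
    rw [sub_add_cancel, add_sub_cancel_right, sub_sub, add_assoc i]
    linear_combination CharTwo.add_self_eq_zero (f (i - 2 ^ n)) + CharTwo.add_self_eq_zero (f i)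
      + CharTwo.add_self_eq_zero (f (i + 2 ^ n))

/-- The evolution is periodic with period `2 ^ n` if the width divides `2 ^ (n + 1)`. -/
theorem fibonacciStep_pow_eq_one {n : ℕ} (hw : w ∣ 2 * 2 ^ n) : fibonacciStep w ^ 2 ^ n = 1 := by
  ext1 f
  ext i
  have h0 : ((2 ^ n : ℕ) : ZMod w) + (2 ^ n : ℕ) = 0 := by
    rw [← two_mul]
    exact_mod_cast (ZMod.natCast_eq_zero_iff _ _).2 hw
  -- The shifts by `2 ^ n` and `-2 ^ n` agree modulo `w`, so the outer terms cancel.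
  rw [fibonacciStep_pow_two_pow, sub_eq_add_neg, ← eq_neg_of_add_eq_zero_left h0]
  rw [Module.End.one_apply]
  linear_combination CharTwo.add_self_eq_zero (f (i + (2 ^ n : ℕ)))

variable [NeZero w] [NeZero h]

theorem fibonacciCheck_mulVec (x : ZMod w × ZMod h → ZMod 2) (i : ZMod w) (j : ZMod h) :
    (fibonacciCheck w h *ᵥ x) (i, j) = fibonacciStep w (fun i => x (i, j)) i + x (i, j + 1) := by
  change (Pi.single (i - 1, j) 1 + Pi.single (i, j) 1 + Pi.single (i + 1, j) 1
    + Pi.single (i, j + 1) 1) ⬝ᵥ x = _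
  simp [add_dotProduct, fibonacciStep_apply]

theorem fibonacciCheck_mulVec_eq_zero_iff (x : ZMod w × ZMod h → ZMod 2) :
    fibonacciCheck w h *ᵥ x = 0 ↔
      ∀ j, (fun i => x (i, j + 1)) = fibonacciStep w fun i => x (i, j) := by
  constructor
  · intro hx j
    ext i
    have := congrFun hx (i, j)
    rw [fibonacciCheck_mulVec] at this
    exact (CharTwo.add_eq_zero.1 this).symm
  · intro hx
    ext ⟨i, j⟩
    rw [fibonacciCheck_mulVec, ← hx]
    exact CharTwo.add_self_eq_zero _

theorem row_eq_fibonacciStep_pow {x : ZMod w × ZMod h → ZMod 2} (hx : fibonacciCheck w h *ᵥ x = 0)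
    (j : ZMod h) (n : ℕ) :
    (fun i => x (i, j + n)) = (fibonacciStep w ^ n) fun i => x (i, j) := by
  induction n with
  | zero => simp
  | succ n ih =>
    rw [pow_succ', Module.End.mul_apply, ← ih, ← (fibonacciCheck_mulVec_eq_zero_iff x).1 hx]
    push_cast
    rw [add_assoc]

/-- If the evolution has period `h`, a codeword is determined by its first row, which is arbitrary. -/
def kerFibonacciEquiv (hT : fibonacciStep w ^ h = 1) :
    LinearMap.ker (fibonacciCheck w h).mulVecLin ≃ₗ[ZMod 2] (ZMod w → ZMod 2) where
  toFun x := fun i => x.1 (i, 0)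
  invFun f := ⟨fun p => (fibonacciStep w ^ p.2.val) f p.1, by
    rw [LinearMap.mem_ker, mulVecLin_apply, fibonacciCheck_mulVec_eq_zero_iff]
    intro j
    change (fibonacciStep w ^ (j + 1).val) f = fibonacciStep w ((fibonacciStep w ^ j.val) f)
    rw [← Module.End.mul_apply, ← pow_succ', ZMod.val_add, ZMod.val_one_eq_one_mod,
      Nat.add_mod_mod, ← pow_mod_orderOf, ← pow_mod_orderOf _ (j.val + 1),
      Nat.mod_mod_of_dvd _ (orderOf_dvd_of_pow_eq_one hT)]⟩
  left_inv x := by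
    refine Subtype.ext (funext fun ⟨i, j⟩ => ?_)
    have := row_eq_fibonacciStep_pow x.2 0 j.val
    rw [zero_add, ZMod.natCast_zmod_val] at this
    exact (congrFun this i).symm
  right_inv f := by simp
  map_add' _ _ := rfl
  map_smul' _ _ := rfl

theorem finrank_ker_fibonacciCheck (hT : fibonacciStep w ^ h = 1) :
    Module.finrank (ZMod 2) (LinearMap.ker (fibonacciCheck w h).mulVecLin) = w := by
  rw [(kerFibonacciEquiv hT).finrank_eq, Module.finrank_fintype_fun_eq_card, ZMod.card]

theorem natCast_hammingNorm {α : Type*} [Fintype α] (f : α → ZMod 2) :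
    (hammingNorm f : ZMod 2) = ∑ i, f i := by
  rw [hammingNorm, Finset.card_filter, Nat.cast_sum]
  refine Finset.sum_congr rfl fun i _ => ?_
  generalize f i = a
  revert a
  decide

/-- Each entry is counted three times in the image, an odd number. -/
theorem hammingNorm_fibonacciStep_parity (f : ZMod w → ZMod 2) :
    hammingNorm (fibonacciStep w f) % 2 = hammingNorm f % 2 := by
  have h : (hammingNorm (fibonacciStep w f) : ZMod 2) = hammingNorm f := by
    rw [natCast_hammingNorm, natCast_hammingNorm]
    simp only [fibonacciStep_apply, Finset.sum_add_distrib]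
    rw [show ∑ i, f (i - 1) = ∑ i, f i from Equiv.sum_comp (Equiv.subRight (1 : ZMod w)) f,
      show ∑ i, f (i + 1) = ∑ i, f i from Equiv.sum_comp (Equiv.addRight (1 : ZMod w)) f,
      CharTwo.add_self_eq_zero, zero_add]
  exact (ZMod.natCast_eq_natCast_iff' _ _ _).1 h

theorem one_ne_zero_of_two_le {n : ℕ} (hn : 2 ≤ n) : (1 : ZMod n) ≠ 0 := by
  have : Fact (1 < n) := ⟨hn⟩
  exact one_ne_zero

theorem one_add_one_ne_zero_of_three_le {n : ℕ} (hn : 3 ≤ n) : (1 : ZMod n) + 1 ≠ 0 := by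
  intro h
  have h' : ((2 : ℕ) : ZMod n) = 0 := by
    rw [← h]
    norm_num
  exact absurd (Nat.le_of_dvd two_pos ((ZMod.natCast_eq_zero_iff _ _).1 h')) (by omega)

theorem sub_one_ne_add_one {n : ℕ} (hn : 3 ≤ n) (i : ZMod n) : i - 1 ≠ i + 1 := by
  intro h
  exact one_add_one_ne_zero_of_three_le hn (by linear_combination -h)

theorem hammingNorm_fibonacciStep_of_one (hw : 3 ≤ w) {f : ZMod w → ZMod 2}
    (hf : hammingNorm f = 1) : 3 ≤ hammingNorm (fibonacciStep w f) := by
  obtain ⟨i, hi⟩ := Finset.card_eq_one.1 hf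
  have hne : ∀ k, f k ≠ 0 ↔ k = i := fun k => by
    rw [← Finset.mem_singleton, ← hi]
    simp
  have h1 : (1 : ZMod w) ≠ 0 := one_ne_zero_of_two_le (by omega)
  have h2 := one_add_one_ne_zero_of_three_le hw
  have hz : ∀ k, k ≠ i → f k = 0 := fun k hk => not_not.1 ((hne k).not.2 hk)
  have hfi : f i ≠ 0 := (hne i).2 rfl
  have hcard : ({i - 1, i, i + 1} : Finset (ZMod w)).card = 3 := by
    refine Finset.card_eq_three.2 ⟨_, _, _, ?_, ?_, ?_, rfl⟩
    · simpa using h1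
    · exact sub_one_ne_add_one hw i
    · simpa using h1
  rw [← hcard]
  refine Finset.card_le_card fun k hk => Finset.mem_filter.2 ⟨Finset.mem_univ _, ?_⟩
  simp only [Finset.mem_insert, Finset.mem_singleton] at hk
  rw [fibonacciStep_apply]
  rcases hk with rfl | rfl | rfl
  · rw [hz (i - 1 - 1) (fun h => h2 (by linear_combination -h)), hz (i - 1) (by simpa using h1),
      zero_add, zero_add, sub_add_cancel]
    exact hfi
  · rw [hz (k - 1) (by simpa using h1), hz (k + 1) (by simpa using h1), zero_add, add_zero]
    exact hfi
  · rw [hz (i + 1 + 1) (fun h => h2 (by linear_combination h)), hz (i + 1) (by simpa using h1),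
      add_zero, add_zero, add_sub_cancel_right]
    exact hfi

/-- A nonzero Fibonacci codeword has at least two nonzero entries per row on average. -/
theorem two_mul_le_hammingNorm (hw : 3 ≤ w) {x : ZMod w × ZMod h → ZMod 2}
    (hx : fibonacciCheck w h *ᵥ x = 0) (hx0 : x ≠ 0) : 2 * h ≤ hammingNorm x := by
  have hstep := (fibonacciCheck_mulVec_eq_zero_iff x).1 hx
  -- A zero row would propagate around the cycle to every other row.
  have hpos : ∀ j, 0 < hammingNorm fun i => x (i, j) := by
    intro j
    rw [hammingNorm_pos_iff]
    intro h0
    apply hx0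
    ext ⟨i, k⟩
    have := row_eq_fibonacciStep_pow hx j (k - j).val
    rw [h0, map_zero, ZMod.natCast_zmod_val, add_sub_cancel] at this
    exact congrFun this i
  -- Two positive weights of equal parity sum to at least four unless both are one, and that case is
  -- excluded by `hammingNorm_fibonacciStep_of_one`.
  have hpair : ∀ j, 4 ≤ (hammingNorm fun i => x (i, j)) + hammingNorm fun i => x (i, j + 1) := by
    intro j
    have h1 := hpos j
    have h2 := hpos (j + 1)
    have h3 := hammingNorm_fibonacciStep_parity fun i => x (i, j)
    have h4 := @hammingNorm_fibonacciStep_of_one w _ hw fun i => x (i, j)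
    rw [← hstep] at h3 h4
    omega
  have hsum : ∑ j : ZMod h, ((hammingNorm fun i => x (i, j)) + hammingNorm fun i => x (i, j + 1)) =
      hammingNorm x + hammingNorm x := by
    rw [Finset.sum_add_distrib, hammingNorm_prod]
    exact congrArg _ (Equiv.sum_comp (Equiv.addRight (1 : ZMod h)) fun j => hammingNorm fun i => x (i, j))
  have := Finset.card_nsmul_le_sum Finset.univ _ 4 fun j _ => hpair j
  rw [hsum, Finset.card_univ, ZMod.card, smul_eq_mul] at this
  omega

theorem fibonacciCheck_isClassicalCode (hw : 3 ≤ w) (hT : fibonacciStep w ^ h = 1) :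
    ∃ d, IsClassicalCode (fibonacciCheck w h) (w * h) w d ∧ 2 * h ≤ d := by
  have hne : {n : ℕ | ∃ x : ZMod w × ZMod h → ZMod 2,
      fibonacciCheck w h *ᵥ x = 0 ∧ x ≠ 0 ∧ hammingNorm x = n}.Nonempty := by
    have h1 : (kerFibonacciEquiv hT).symm 1 ≠ 0 := by
      rw [Ne, LinearEquiv.map_eq_zero_iff]
      exact one_ne_zero
    exact ⟨_, _, ((kerFibonacciEquiv hT).symm 1).2, fun h => h1 (Subtype.ext h), rfl⟩
  refine ⟨_, ⟨?_, finrank_ker_fibonacciCheck hT, Nat.sInf_mem hne, fun n hn => Nat.sInf_le hn⟩, ?_⟩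
  · simp [ZMod.card]
  · obtain ⟨x, hx, hx0, hd⟩ := Nat.sInf_mem hne
    rw [← hd]
    exact two_mul_le_hammingNorm hw hx hx0

/-- The four sites in the support of a Fibonacci check. -/
def fibonacciSites (r : ZMod w × ZMod h) : Finset (ZMod w × ZMod h) :=
  {(r.1 - 1, r.2), (r.1, r.2), (r.1 + 1, r.2), (r.1, r.2 + 1)}

theorem fibonacciCheck_ne_zero_iff (hw : 3 ≤ w) (hh : 2 ≤ h) (r b : ZMod w × ZMod h) :
    fibonacciCheck w h r b ≠ 0 ↔ b ∈ fibonacciSites r := by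
  have h1 : (1 : ZMod w) ≠ 0 := one_ne_zero_of_two_le (by omega)
  have h2 := sub_one_ne_add_one hw r.1
  have h3 : (1 : ZMod h) ≠ 0 := one_ne_zero_of_two_le hh
  simp only [fibonacciSites, Finset.mem_insert, Finset.mem_singleton]
  constructor
  · intro hb
    by_contra! hc
    obtain ⟨c1, c2, c3, c4⟩ := hc
    simp [fibonacciCheck, Pi.single_eq_of_ne c1, Pi.single_eq_of_ne c2, Pi.single_eq_of_ne c3,
      Pi.single_eq_of_ne c4] at hb
  · rintro (rfl | rfl | rfl | rfl) <;>
      simp [fibonacciCheck, Prod.ext_iff, h1, h2, h2.symm, h3]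

theorem card_fibonacciSites (hw : 3 ≤ w) (hh : 2 ≤ h) (r : ZMod w × ZMod h) :
    (fibonacciSites r).card = 4 := by
  have h1 : (1 : ZMod w) ≠ 0 := one_ne_zero_of_two_le (by omega)
  have h2 := sub_one_ne_add_one hw r.1
  have h3 : (1 : ZMod h) ≠ 0 := one_ne_zero_of_two_le hh
  rw [fibonacciSites, Finset.card_insert_of_notMem, Finset.card_insert_of_notMem,
    Finset.card_insert_of_notMem, Finset.card_singleton] <;> simp [Prod.ext_iff, h1, h2, h3]

theorem hammingNorm_fibonacciCheck_row (hw : 3 ≤ w) (hh : 2 ≤ h) (r : ZMod w × ZMod h) :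
    hammingNorm (fibonacciCheck w h r) = 4 := by
  refine (congrArg Finset.card ?_).trans (card_fibonacciSites hw hh r)
  ext b
  simpa using fibonacciCheck_ne_zero_iff hw hh r b

theorem hammingNorm_fibonacciCheck_col (hw : 3 ≤ w) (hh : 2 ≤ h) (b : ZMod w × ZMod h) :
    hammingNorm (fun r => fibonacciCheck w h r b) = 4 := by
  rw [← hammingNorm_fibonacciCheck_row hw hh (-b)]
  -- If `b = r + s` for an offset `s`, then `-r = -b + s`, so negation turns columns into rows.
  refine Finset.card_equiv (Equiv.neg _) fun r => ?_
  simp only [Finset.mem_filter, Finset.mem_univ, true_and, Equiv.neg_apply,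
    fibonacciCheck_ne_zero_iff hw hh, fibonacciSites, Finset.mem_insert, Finset.mem_singleton,
    Prod.ext_iff, Prod.fst_neg, Prod.snd_neg]
  grind

end Fibonacci

/-! ### Folding a cycle onto a line -/

section Placement

/-- The position on a line of a point of the cycle of length `n`, folded onto the line. -/
def foldCycle {n : ℕ} (i : ZMod n) : ℤ := min (2 * i.val : ℤ) (2 * (n - i.val) - 1)

theorem foldCycle_injective {n : ℕ} [NeZero n] : Function.Injective (foldCycle (n := n)) := by
  intro i j hij
  have hi := ZMod.val_lt i
  have hj := ZMod.val_lt j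
  apply ZMod.val_injective n
  unfold foldCycle at hij
  omega

/-- The fold runs out along even positions and returns along odd ones, so the closing edge of the
cycle stays short as well. -/
theorem abs_foldCycle_add_one_sub_le {n : ℕ} [NeZero n] (i : ZMod n) :
    |foldCycle (i + 1) - foldCycle i| ≤ 2 := by
  have hi := ZMod.val_lt i
  have h : (i + 1).val = i.val + 1 ∨ ((i + 1).val = 0 ∧ i.val + 1 = n) := by
    rw [ZMod.val_add, ZMod.val_one_eq_one_mod, Nat.add_mod_mod]
    rcases lt_or_ge (i.val + 1) n with h | h
    · exact Or.inl (Nat.mod_eq_of_lt h)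
    · have : i.val + 1 = n := by omega
      exact Or.inr ⟨by rw [this, Nat.mod_self], this⟩
  unfold foldCycle
  rw [abs_le]
  omega

end Placement

/-! ### Geometric locality in two and three dimensions -/

section Locality

theorem isGeometricallyLocal_of_center {ρ ι : Type*} {dim R : ℕ} {supp : ρ → Finset ι}
    (pos : ι → Fin dim → ℤ) (hpos : Function.Injective pos)
    (h : ∀ r, ∃ c : Fin dim → ℤ, ∀ i ∈ supp r, ∀ a, |pos i a - c a| ≤ R) :
    IsGeometricallyLocal dim (2 * R) supp := by
  refine ⟨pos, hpos, fun r i hi j hj a => ?_⟩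
  obtain ⟨c, hc⟩ := h r
  have h1 := abs_le.1 (hc i hi a)
  have h2 := abs_le.1 (hc j hj a)
  rw [abs_le]
  push_cast
  omega

variable {w h : ℕ} [NeZero w] [NeZero h]

theorem abs_foldCycle_sub_le_of_mem_fibonacciSites {r b : ZMod w × ZMod h}
    (hb : b ∈ fibonacciSites r) :
    |foldCycle b.1 - foldCycle r.1| ≤ 2 ∧ |foldCycle b.2 - foldCycle r.2| ≤ 2 := by
  simp only [fibonacciSites, Finset.mem_insert, Finset.mem_singleton] at hb
  rcases hb with rfl | rfl | rfl | rfl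
  · have := abs_foldCycle_add_one_sub_le (r.1 - 1)
    rw [sub_add_cancel, abs_sub_comm] at this
    exact ⟨this, by simp⟩
  · simp
  · exact ⟨abs_foldCycle_add_one_sub_le _, by simp⟩
  · exact ⟨by simp, abs_foldCycle_add_one_sub_le _⟩

theorem fibonacciCheck_isGeometricallyLocal (hw : 3 ≤ w) (hh : 2 ≤ h) :
    IsGeometricallyLocal 2 4 fun r => Finset.univ.filter fun b => fibonacciCheck w h r b ≠ 0 := by
  refine isGeometricallyLocal_of_center (R := 2) (fun b => ![foldCycle b.1, foldCycle b.2]) ?_ ?_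
  · intro b c hbc
    have h0 := congrFun hbc 0
    have h1 := congrFun hbc 1
    exact Prod.ext (foldCycle_injective h0) (foldCycle_injective h1)
  · intro r
    refine ⟨![foldCycle r.1, foldCycle r.2], fun b hb => ?_⟩
    obtain ⟨h0, h1⟩ := abs_foldCycle_sub_le_of_mem_fibonacciSites
      ((fibonacciCheck_ne_zero_iff hw hh r b).1 (Finset.mem_filter.1 hb).2)
    exact Fin.forall_fin_two.2 ⟨h0, h1⟩

theorem forall_fin_three {P : Fin 3 → Prop} : (∀ a, P a) ↔ P 0 ∧ P 1 ∧ P 2 := by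
  simp [Fin.forall_fin_succ]

theorem eq_of_one_apply_ne_zero {α : Type*} [DecidableEq α] {a b : α}
    (hab : (1 : Matrix α α (ZMod 2)) a b ≠ 0) : a = b :=
  not_not.1 fun hne => hab (Matrix.one_apply_ne hne)

theorem abs_layer_sub_le {D : ℕ} {a : Fin (D - 1)} {k : Fin D} (hak : repetitionCheck D a k ≠ 0) :
    |(2 * (a : ℤ) + 1) - 2 * (k : ℤ)| ≤ 2 := by
  rw [abs_le]
  rcases (repetitionCheck_ne_zero_iff a k).1 hak with rfl | rfl <;>
    simp only [repLeft, repRight] <;> omega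

/-- Qubits of the first kind occupy the even layers, those of the second kind the odd ones. -/
def productLayer {α β : Type*} {D : ℕ} : α × Fin D ⊕ β × Fin (D - 1) → ℤ :=
  Sum.elim (fun p => 2 * (p.2 : ℤ)) fun p => 2 * (p.2 : ℤ) + 1

theorem fibonacciHGP_isGeometricallyLocal (hw : 3 ≤ w) (hh : 2 ≤ h) (D : ℕ) :
    IsGeometricallyLocal 3 4 fun r => pauliSupport (fibonacciHGP w h D r) := by
  refine isGeometricallyLocal_of_center (R := 2) (fun q =>
    ![foldCycle (Sum.elim Prod.fst Prod.fst q).1, foldCycle (Sum.elim Prod.fst Prod.fst q).2,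
      productLayer q]) ?_ ?_
  · intro p q hpq
    have h0 := foldCycle_injective (congrFun hpq 0)
    have h1 := foldCycle_injective (congrFun hpq 1)
    have h2 : productLayer p = productLayer q := congrFun hpq 2
    rcases p with ⟨p, j⟩ | ⟨p, j⟩ <;> rcases q with ⟨q, k⟩ | ⟨q, k⟩ <;>
      simp only [productLayer, Sum.elim_inl, Sum.elim_inr] at h0 h1 h2
    · rw [(Prod.ext h0 h1 : p = q), Fin.ext (show j.val = k.val by omega)]
    · omega
    · omega
    · rw [(Prod.ext h0 h1 : p = q), Fin.ext (show j.val = k.val by omega)]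
  · rintro (⟨r, k⟩ | ⟨b, a⟩)
    -- The centre is the natural place of the check: `X`-checks sit on even layers, `Z`-checks on
    -- odd ones.
    · refine ⟨![foldCycle r.1, foldCycle r.2, 2 * (k : ℤ)], fun q hq => ?_⟩
      have hq' : hgpX (fibonacciCheck w h) (repetitionCheck D) (r, k) q ≠ 0 :=
        (Finset.mem_filter.1 hq).2.resolve_right fun hc => hc rfl
      rcases q with ⟨b, j⟩ | ⟨s, a⟩
      · obtain ⟨hb, hj⟩ := mul_ne_zero_iff.1 hq'
        obtain ⟨h0, h1⟩ := abs_foldCycle_sub_le_of_mem_fibonacciSites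
          ((fibonacciCheck_ne_zero_iff hw hh r b).1 hb)
        obtain rfl := eq_of_one_apply_ne_zero hj
        exact forall_fin_three.2 ⟨h0, h1, by simp [productLayer]⟩
      · obtain ⟨hs, ha⟩ := mul_ne_zero_iff.1 hq'
        obtain rfl := eq_of_one_apply_ne_zero hs
        exact forall_fin_three.2 ⟨by simp, by simp, abs_layer_sub_le ha⟩
    · refine ⟨![foldCycle b.1, foldCycle b.2, 2 * (a : ℤ) + 1], fun q hq => ?_⟩
      have hq' : hgpZ (fibonacciCheck w h) (repetitionCheck D) (b, a) q ≠ 0 :=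
        (Finset.mem_filter.1 hq).2.resolve_left fun hc => hc rfl
      rcases q with ⟨s, k⟩ | ⟨r, j⟩
      · obtain ⟨hs, hk⟩ := mul_ne_zero_iff.1 hq'
        obtain rfl := eq_of_one_apply_ne_zero hs
        refine forall_fin_three.2 ⟨by simp, by simp, ?_⟩
        have := abs_layer_sub_le hk
        rwa [abs_sub_comm] at this
      · obtain ⟨hr, hj⟩ := mul_ne_zero_iff.1 hq'
        obtain ⟨h0, h1⟩ := abs_foldCycle_sub_le_of_mem_fibonacciSites
          ((fibonacciCheck_ne_zero_iff hw hh r b).1 hr)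
        obtain rfl := eq_of_one_apply_ne_zero hj
        rw [abs_sub_comm] at h0 h1
        exact forall_fin_three.2 ⟨h0, h1, by simp [productLayer]⟩

end Locality

/-! ### Weights of the Fibonacci product code -/

section Weights

variable {w h D : ℕ} [NeZero w] [NeZero h]

theorem fibonacciHGP_checkWeight (hw : 3 ≤ w) (hh : 2 ≤ h) (hD : 2 ≤ D) :
    checkWeight (fibonacciHGP w h D) = 6 := by
  refine le_antisymm (Finset.sup_le ?_) ?_
  · rintro (⟨r, k⟩ | ⟨b, a⟩) -
    · rw [fibonacciHGP, hammingNorm_hgp_row_inl, hammingNorm_hgpX_row,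
        hammingNorm_fibonacciCheck_row hw hh]
      exact Nat.add_le_add_left (hammingNorm_repetitionCheck_col_le k) 4
    · rw [fibonacciHGP, hammingNorm_hgp_row_inr, hammingNorm_hgpZ_row,
        hammingNorm_fibonacciCheck_col hw hh, hammingNorm_repetitionCheck_row]
  -- A `Z`-check is the witness: repetition rows always have weight two, whereas for `D = 2` no
  -- column does.
  · refine le_trans (le_of_eq ?_) (Finset.le_sup (Finset.mem_univ (Sum.inr (0, ⟨0, by omega⟩))))
    rw [fibonacciHGP, hammingNorm_hgp_row_inr, hammingNorm_hgpZ_row,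
      hammingNorm_fibonacciCheck_col hw hh, hammingNorm_repetitionCheck_row]

theorem fibonacciHGP_qubitUse (hw : 3 ≤ w) (hh : 2 ≤ h) (hD : 2 ≤ D) :
    qubitUse (fibonacciHGP w h D) = 6 := by
  refine le_antisymm (Finset.sup_le ?_) ?_
  · rintro (⟨b, k⟩ | ⟨r, a⟩) -
    · rw [fibonacciHGP, hammingNorm_hgp_col_inl, hammingNorm_hgp_col_inr, hammingNorm_hgpX_col_inl,
        hammingNorm_hgpZ_col_inl, hammingNorm_fibonacciCheck_col hw hh]
      exact Nat.add_le_add_left (hammingNorm_repetitionCheck_col_le k) 4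
    · rw [fibonacciHGP, hammingNorm_hgp_col_inl, hammingNorm_hgp_col_inr, hammingNorm_hgpX_col_inr,
        hammingNorm_hgpZ_col_inr, hammingNorm_fibonacciCheck_row hw hh,
        hammingNorm_repetitionCheck_row]
  · refine le_trans (le_of_eq ?_) (Finset.le_sup (Finset.mem_univ (Sum.inr (0, ⟨0, by omega⟩))))
    rw [fibonacciHGP, hammingNorm_hgp_col_inl, hammingNorm_hgp_col_inr, hammingNorm_hgpX_col_inr,
      hammingNorm_hgpZ_col_inr, hammingNorm_fibonacciCheck_row hw hh,
      hammingNorm_repetitionCheck_row]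

theorem fibonacciHGP_columnWeight_X (hw : 3 ≤ w) (hh : 2 ≤ h) (hD : 0 < D) :
    columnWeight (hgpX (fibonacciCheck w h) (repetitionCheck D)) = 4 := by
  refine le_antisymm (Finset.sup_le ?_) ?_
  · rintro (⟨b, k⟩ | ⟨r, a⟩) -
    · rw [hammingNorm_hgpX_col_inl, hammingNorm_fibonacciCheck_col hw hh]
    · rw [hammingNorm_hgpX_col_inr, hammingNorm_repetitionCheck_row]
      norm_num
  · refine le_trans (le_of_eq ?_) (Finset.le_sup (Finset.mem_univ (Sum.inl (0, ⟨0, hD⟩))))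
    rw [hammingNorm_hgpX_col_inl, hammingNorm_fibonacciCheck_col hw hh]

theorem fibonacciHGP_columnWeight_Z (hw : 3 ≤ w) (hh : 2 ≤ h) (hD : 2 ≤ D) :
    columnWeight (hgpZ (fibonacciCheck w h) (repetitionCheck D)) = 4 := by
  refine le_antisymm (Finset.sup_le ?_) ?_
  · rintro (⟨b, k⟩ | ⟨r, a⟩) -
    · rw [hammingNorm_hgpZ_col_inl]
      exact (hammingNorm_repetitionCheck_col_le k).trans (by norm_num)
    · rw [hammingNorm_hgpZ_col_inr, hammingNorm_fibonacciCheck_row hw hh]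
  · refine le_trans (le_of_eq ?_) (Finset.le_sup (Finset.mem_univ (Sum.inr (0, ⟨0, by omega⟩))))
    rw [hammingNorm_hgpZ_col_inr, hammingNorm_fibonacciCheck_row hw hh]

end Weights

/-! ### Assembly of parameters and asymptotic bounds -/

theorem fibonacciHGP_isStabilizerCode {w h d D : ℕ} [NeZero w] [NeZero h]
    (hF : IsClassicalCode (fibonacciCheck w h) (w * h) w d) (hD : 0 < D) :
    IsStabilizerCode (fibonacciHGP w h D) (w * h * D + w * h * (D - 1)) w (min d D) := by
  have := hgp_repetition_isStabilizerCode _ hF hD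
  rwa [hF.length] at this

/-- A code on `l * h * D + l * h * (D - 1)` qubits with `h ≤ l` has at most `2 * l ^ 2 * D` of them and
`l * D ^ 2` is at least half of that number if `l ≤ D`. -/
theorem product_length_bounds {l h D : ℕ} (hh : 0 < h) (hl : h ≤ l) (hD : l ≤ D) :
    ((l * h * D + l * h * (D - 1) : ℕ) : ℝ) ≤ 2 * (l : ℝ) ^ 2 * D ∧
      1 / 2 ≤ (l : ℝ) * (D : ℝ) ^ 2 / (l * h * D + l * h * (D - 1) : ℕ) := by
  have hn : l * h * D + l * h * (D - 1) ≤ 2 * l ^ 2 * D := by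
    calc l * h * D + l * h * (D - 1) ≤ l * l * D + l * l * D := by gcongr; omega
      _ = 2 * l ^ 2 * D := by ring
  have hD2 : 2 * l ^ 2 * D ≤ 2 * (l * D ^ 2) := by
    calc 2 * l ^ 2 * D = 2 * (l * (l * D)) := by ring
      _ ≤ 2 * (l * (D * D)) := by gcongr
      _ = 2 * (l * D ^ 2) := by ring
  have hpos : 0 < l * h * D + l * h * (D - 1) :=
    Nat.add_pos_left (Nat.mul_pos (Nat.mul_pos (by omega) hh) (by omega)) _
  have hpos' : (0 : ℝ) < (l * h * D + l * h * (D - 1) : ℕ) := by exact_mod_cast hpos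
  refine ⟨by exact_mod_cast hn, ?_⟩
  have hle : ((l * h * D + l * h * (D - 1) : ℕ) : ℝ) ≤ 2 * ((l : ℝ) * (D : ℝ) ^ 2) := by
    exact_mod_cast hn.trans hD2
  rw [le_div_iff₀ hpos']
  linarith

theorem mainTheorem1 :
    ∃ (R : ℕ) (c C : ℝ), 0 < c ∧
      ∀ m l h : ℕ, 2 ≤ m → l = 2 ^ m → (h = l ∨ 2 * h = l) → ∀ [NeZero l] [NeZero h],
        ∃ d₁ : ℕ,
          -- the classical code
          (IsClassicalCode (fibonacciCheck l h) (l * h) l d₁ ∧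
            ((l * h : ℕ) : ℝ) ≤ C * (l : ℝ) ^ 2 ∧ l ≤ d₁ ∧
            (∀ r, hammingNorm (fibonacciCheck l h r) = 4) ∧
            IsGeometricallyLocal 2 R (fun r =>
              Finset.univ.filter fun b => fibonacciCheck l h r b ≠ 0)) ∧
          -- the hypergraph product with a repetition code of any length `D ≥ 2`
          (∀ D : ℕ, 2 ≤ D →
            IsStabilizerCode (fibonacciHGP l h D) (l * h * D + l * h * (D - 1)) l (min d₁ D) ∧
            IsXDistance (fibonacciHGP l h D) D ∧
            IsZDistance (fibonacciHGP l h D) d₁ ∧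
            checkWeight (fibonacciHGP l h D) = 6 ∧
            qubitUse (fibonacciHGP l h D) = 6 ∧
            columnWeight (hgpX (fibonacciCheck l h) (repetitionCheck D)) = 4 ∧
            columnWeight (hgpZ (fibonacciCheck l h) (repetitionCheck D)) = 4 ∧
            IsGeometricallyLocal 3 R (fun r => pauliSupport (fibonacciHGP l h D r))) ∧
          -- `D = d₁`: the two distances of the product code agree exactly
          (∃ n : ℕ, IsStabilizerCode (fibonacciHGP l h d₁) n l d₁ ∧
            IsXDistance (fibonacciHGP l h d₁) d₁ ∧ IsZDistance (fibonacciHGP l h d₁) d₁ ∧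
            (n : ℝ) ≤ C * (l : ℝ) ^ 2 * d₁ ∧
            c ≤ (l : ℝ) * (d₁ : ℝ) ^ 2 / n) ∧
          -- `D = l`: the length matches the guaranteed classical distance `l`
          (∃ n : ℕ, IsStabilizerCode (fibonacciHGP l h l) n l l ∧
            (n : ℝ) ≤ C * (l : ℝ) ^ 3 ∧
            c ≤ (l : ℝ) * (l : ℝ) ^ 2 / n) := by
  refine ⟨4, 1 / 2, 2, by norm_num, ?_⟩
  intro m l h hm hl hh _ _
  have hl4 : 4 ≤ l := by
    rw [hl]
    exact Nat.pow_le_pow_right two_pos hm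
  have hw : 3 ≤ l := by omega
  have hh2 : 2 ≤ h := by omega
  -- The period `l / 2` already suffices; for `h = l` the divisibility in `fibonacciStep_pow_eq_one`
  -- holds with a factor of two to spare.
  have hT : fibonacciStep l ^ h = 1 := by
    rcases hh with rfl | hh
    · rw [hl]
      exact fibonacciStep_pow_eq_one (Dvd.intro_left 2 rfl)
    · obtain ⟨n, rfl⟩ : ∃ n, m = n + 1 := ⟨m - 1, by omega⟩
      have : h = 2 ^ n := by
        rw [pow_succ] at hl
        omega
      subst this
      exact fibonacciStep_pow_eq_one (by rw [hh])
  obtain ⟨d, hF, hd⟩ := fibonacciCheck_isClassicalCode hw hT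
  -- This is `l ≤ 2 * h ≤ d`, the reason why halving the height is harmless.
  have hld : l ≤ d := by omega
  have hhl : h ≤ l := by omega
  have hX : ∀ D, 0 < D → IsXDistance (fibonacciHGP l h D) D :=
    fun D hD => hgp_repetition_isXDistance _ hF hD
  have hZ : ∀ D, 0 < D → IsZDistance (fibonacciHGP l h D) d :=
    fun D hD => hgp_repetition_isZDistance _ hF hD
  have hS : ∀ D, 0 < D → _ := fun D hD => fibonacciHGP_isStabilizerCode hF hD
  refine ⟨d, ⟨hF, ?_, hld, hammingNorm_fibonacciCheck_row hw hh2,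
    fibonacciCheck_isGeometricallyLocal hw hh2⟩, fun D hD => ?_, ?_, ?_⟩
  · have : l * h ≤ 2 * l ^ 2 := by nlinarith
    exact_mod_cast this
  · exact ⟨hS D (by omega), hX D (by omega), hZ D (by omega), fibonacciHGP_checkWeight hw hh2 hD,
      fibonacciHGP_qubitUse hw hh2 hD, fibonacciHGP_columnWeight_X hw hh2 (by omega),
      fibonacciHGP_columnWeight_Z hw hh2 hD, fibonacciHGP_isGeometricallyLocal hw hh2 D⟩
  · obtain ⟨h1, h2⟩ := product_length_bounds (by omega) hhl hld
    exact ⟨_, by simpa using hS d (by omega), hX d (by omega), hZ d (by omega), h1, h2⟩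
  · obtain ⟨h1, h2⟩ := product_length_bounds (by omega) hhl (le_refl l)
    refine ⟨_, by simpa [hld] using hS l (by omega), ?_, h2⟩
    exact h1.trans_eq (by ring)
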